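/- Let $(R,\mathfrak m)$ be a Noetherian local ring and let $M$ be a finitely generated $R$-module of dimension $t\ge 1$ (the Krull dimension of $\operatorname{Supp} M$). Write $\ell_R$ for length, and for a submodule $N\subseteq M$ put $N:_M\mathfrak m=\{x\in M\mid \mathfrak m x\subseteq N\}$. Then there are integers $\mathrm e_{\mathfrak m}^0(M),\dots,\mathrm e_{\mathfrak m}^t(M)$ and $\mathrm f_{\mathfrak m}^0(M),\dots,\mathrm f_{\mathfrak m}^{t-1}(M)$ such that for all $n\gg 0$ the following lengths are finite and \[ \ell_R(M/\mathfrak m^{n+1}M)=\sum_{i=0}^{t}(-1)^i\,\mathrm e_{\mathfrak m}^i(M)\binom{n+t-i}{t-i}, \] \[ \ell_R\big((\mathfrak m^{n+1}M:_M\mathfrak m)/\mathfrak m^{n+1}M\big)=\sum_{i=0}^{t-1}(-1)^i\,\mathrm f_{\mathfrak m}^i(M)\binom{n+t-1-i}{t-1-i}. \] The leading coefficients $\mathrm e_{\mathfrak m}^0(M)$ (the Hilbert multiplicity) and $\mathrm f_{\mathfrak m}^0(M)$ (the irreducible multiplicity) are uniquely determined, $\ell_R((0):_M\mathfrak m)$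 is finite when $t=1$, and \[ \mathrm f_{\mathfrak m}^0(M)= \begin{cases} \mathrm e_{\mathfrak m}^0(M) & \text{if } t\ne 1,\\ \mathrm e_{\mathfrak m}^0(M)+\ell_R((0):_M\mathfrak m) & \text{if } t=1. \end{cases} \] -/

import Mathlib

namespace IrrMult

section

variable {R : Type*} [CommRing R] {M : Type*} [AddCommGroup M] [Module R M]

/-- The submodule `N :_M J = {x ∈ M | J x ⊆ N}` of `M`. -/
def moduleColon (N : Submodule R M) (J : Ideal R) : Submodule R M where
  carrier := {x | ∀ r ∈ J, r • x ∈ N}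
  zero_mem' := fun r _ => by simp
  add_mem' := fun {a b} ha hb r hr => by
    rw [smul_add]
    exact N.add_mem (ha r hr) (hb r hr)
  smul_mem' := fun c x hx r hr => by
    rw [smul_comm]
    exact N.smul_mem c (hx r hr)

variable (M)

/-- `e 0, …, e t` are integers such that, for all large `n`, the length of `M / I ^ (n + 1) M` is
finite and equal to `∑ i ≤ t, (-1) ^ i * e i * binom (n + t - i) (t - i)`. -/
def HasHilbertCoeffs (I : Ideal R) (t : ℕ) (e : Fin (t + 1) → ℤ) : Prop :=
  ∀ᶠ n : ℕ in Filter.atTop, ∃ k : ℕ,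
    Module.length R (M ⧸ (I ^ (n + 1) • (⊤ : Submodule R M))) = (k : ℕ∞) ∧
    (k : ℤ) = ∑ i : Fin (t + 1),
      (-1) ^ (i : ℕ) * e i * (Nat.choose (n + (t - (i : ℕ))) (t - (i : ℕ)) : ℤ)

/-- `a` is the Hilbert multiplicity of `M` with respect to `I`: the coefficient `e 0` of a family
of Hilbert coefficients of `M`, where `t` is the dimension of `M`. -/
def IsHilbertMultiplicity (I : Ideal R) (a : ℤ) : Prop :=
  ∃ t : ℕ, Module.supportDim R M = (t : WithBot ℕ∞) ∧
    ∃ e : Fin (t + 1) → ℤ, HasHilbertCoeffs M I t e ∧ e 0 = a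

end

section

variable {R : Type*} [CommRing R] [IsLocalRing R] (M : Type*) [AddCommGroup M] [Module R M]

/-- `f 0, …, f (t - 1)` are integers such that, for all large `n`, the length of
`(I ^ (n + 1) M :_M 𝔪) / I ^ (n + 1) M` is finite and equal to
`∑ i ≤ t - 1, (-1) ^ i * f i * binom (n + t - 1 - i) (t - 1 - i)`. -/
def HasIrreducibilityCoeffs (I : Ideal R) (t : ℕ) (f : Fin t → ℤ) : Prop :=
  ∀ᶠ n : ℕ in Filter.atTop, ∃ k : ℕ,
    Module.length R
      (moduleColon (I ^ (n + 1) • (⊤ : Submodule R M)) (IsLocalRing.maximalIdeal R) ⧸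
        (I ^ (n + 1) • (⊤ : Submodule R M)).submoduleOf
          (moduleColon (I ^ (n + 1) • (⊤ : Submodule R M)) (IsLocalRing.maximalIdeal R)))
      = (k : ℕ∞) ∧
    (k : ℤ) = ∑ i : Fin t,
      (-1) ^ (i : ℕ) * f i * (Nat.choose (n + (t - 1 - (i : ℕ))) (t - 1 - (i : ℕ)) : ℤ)

/-- `a` is the irreducible multiplicity of `M` with respect to `I`: the coefficient `f 0` of a
family of irreducibility coefficients of `M`, where `t` is the (positive) dimension of `M`. -/
def IsIrreducibleMultiplicity (I : Ideal R) (a : ℤ) : Prop :=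
  ∃ (t : ℕ) (ht : 0 < t), Module.supportDim R M = (t : WithBot ℕ∞) ∧
    ∃ f : Fin t → ℤ, HasIrreducibilityCoeffs M I t f ∧ f ⟨0, ht⟩ = a

end

end IrrMult

/-!
The graded module `⨁ 𝔪 ^ n M / 𝔪 ^ (n + 1) M` is Noetherian. Letting one generator of the ideal act
on a Noetherian graded subquotient of `M` leaves a kernel and a cokernel on which that generator
acts as zero, so by induction on the number of generators the lengths of the graded pieces are
eventually polynomial. Comparing the `𝔪`-adic filtration with that of an ideal generated by `t`
elements which is primary modulo the annihilator of `M` bounds the degree of `ℓ(M / 𝔪 ^ n M)` by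
`t`.

By the Artin–Rees lemma and the stability of a filtration contained in the `𝔪`-adic one,
`𝔪 ^ (n + 1) M :_M 𝔪 = 𝔪 ^ n M + (0 :_M 𝔪)` for large `n`, and the sum is direct by Artin–Rees
again. Hence `ℓ((𝔪 ^ (n + 1) M :_M 𝔪) / 𝔪 ^ (n + 1) M)` is the first difference of the
Hilbert–Samuel function plus the constant `ℓ(0 :_M 𝔪)`. That difference has degree at most `t - 1`
with the same leading coefficient, and the constant affects this coefficient only if `t = 1`.
-/

open Filter
open scoped fwdDiff

namespace IrrMult

section Sequences

lemma eventuallyEq_const_iff {α : Type*} {h : ℕ → α} {a c : α} (hc : h =ᶠ[atTop] fun _ => c) :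
    (h =ᶠ[atTop] fun _ => a) ↔ a = c :=
  ⟨fun ha => (ha.symm.trans hc).exists.choose_spec, fun hac => hac ▸ hc⟩

section

variable {G : Type*} [AddCommGroup G] {h g : ℕ → G}

lemma fwdDiff_eventuallyEq (H : h =ᶠ[atTop] g) : Δ_[1] h =ᶠ[atTop] Δ_[1] g :=
  EventuallyEq.sub ((tendsto_add_atTop_nat 1).eventually H) H

lemma fwdDiff_iter_eventuallyEq (H : h =ᶠ[atTop] g) (d : ℕ) :
    Δ_[1] ^[d] h =ᶠ[atTop] Δ_[1] ^[d] g := by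
  induction d with
  | zero => exact H
  | succ d ih =>
    simpa only [Function.iterate_succ_apply'] using fwdDiff_eventuallyEq ih

lemma fwdDiff_iter_sub (h g : ℕ → G) (d : ℕ) :
    Δ_[1] ^[d] (h - g) = Δ_[1] ^[d] h - Δ_[1] ^[d] g := by
  simpa only [fwdDiff_aux.coe_fwdDiffₗ_pow] using map_sub (fwdDiff_aux.fwdDiffₗ ℕ G 1 ^ d) h g

lemma fwdDiff_iter_zero (d : ℕ) : Δ_[1] ^[d] (0 : ℕ → G) = 0 :=
  Function.iterate_fixed (fwdDiff_const 1 0) d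

lemma fwdDiff_iter_const (w : G) (d : ℕ) :
    Δ_[1] ^[d] (fun _ : ℕ => w) = fun _ => if d = 0 then w else 0 := by
  cases d with
  | zero => rfl
  | succ d =>
    rw [Function.iterate_succ_apply, fwdDiff_const]
    exact fwdDiff_iter_zero d

lemma fwdDiff_iter_fwdDiff_add_const {d : ℕ} {c : G}
    (hc : Δ_[1] ^[d + 1] h =ᶠ[atTop] fun _ => c) (w : G) :
    Δ_[1] ^[d] (Δ_[1] h + fun _ => w) =ᶠ[atTop] fun _ => c + if d = 0 then w else 0 := by
  rw [fwdDiff_iter_add, fwdDiff_iter_const]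
  exact EventuallyEq.add hc .rfl

lemma exists_eventuallyEq_const_of_fwdDiff (H : Δ_[1] h =ᶠ[atTop] 0) :
    ∃ c : G, h =ᶠ[atTop] fun _ => c := by
  obtain ⟨N, hN⟩ := eventually_atTop.1 H
  refine ⟨h N, eventually_atTop.2 ⟨N, fun n hn => ?_⟩⟩
  induction n, hn using Nat.le_induction with
  | base => rfl
  | succ n hn ih => exact (sub_eq_zero.1 (hN n hn)).trans ih

/-- The sequence `h` agrees for large arguments with a polynomial function of degree less than
`d`, expressed by the vanishing of its `d`-th difference. -/
def EventuallyDegreeLT (h : ℕ → G) (d : ℕ) : Prop := Δ_[1] ^[d] h =ᶠ[atTop] 0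

namespace EventuallyDegreeLT

variable {d d' : ℕ}

lemma mono (hh : EventuallyDegreeLT h d) (hd : d ≤ d') : EventuallyDegreeLT h d' := by
  obtain ⟨k, rfl⟩ := Nat.exists_eq_add_of_le' hd
  rw [EventuallyDegreeLT, Function.iterate_add_apply, ← fwdDiff_iter_zero k]
  exact fwdDiff_iter_eventuallyEq hh k

lemma sub (hh : EventuallyDegreeLT h d) (hg : EventuallyDegreeLT g d) :
    EventuallyDegreeLT (h - g) d := by
  simpa only [EventuallyDegreeLT, fwdDiff_iter_sub, sub_zero] using EventuallyEq.sub hh hg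

lemma exists_fwdDiff_iter_eventuallyEq_const (hh : EventuallyDegreeLT h (d + 1)) :
    ∃ c : G, Δ_[1] ^[d] h =ᶠ[atTop] fun _ => c := by
  rw [EventuallyDegreeLT, Function.iterate_succ_apply'] at hh
  exact exists_eventuallyEq_const_of_fwdDiff hh

end EventuallyDegreeLT

lemma eventuallyDegreeLT_succ_of_fwdDiff_iter {d : ℕ} {c : G}
    (H : Δ_[1] ^[d] h =ᶠ[atTop] fun _ => c) : EventuallyDegreeLT h (d + 1) := by
  rw [EventuallyDegreeLT, Function.iterate_succ_apply']
  exact (fwdDiff_eventuallyEq H).trans (Eventually.of_forall fun _ => sub_self c)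

end

section

variable {h g : ℕ → ℤ} {d : ℕ}

lemma eventually_pos_of_fwdDiff (H : ∀ᶠ n in atTop, 0 < Δ_[1] h n) : ∀ᶠ n in atTop, 0 < h n := by
  obtain ⟨N, hN⟩ := eventually_atTop.1 H
  have growth : ∀ k : ℕ, h N + k ≤ h (N + k) := by
    intro k
    induction k with
    | zero => simp
    | succ k ih =>
      have : 0 < h (N + k + 1) - h (N + k) := hN (N + k) (Nat.le_add_right N k)
      push_cast
      linarith [Int.add_one_le_iff.2 this, add_assoc N k 1 ▸ this]
  filter_upwards [eventually_ge_atTop (N + (1 - h N).toNat)] with n hn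
  have := growth (n - N)
  rw [Nat.add_sub_cancel' (by omega)] at this
  omega

lemma eventually_pos_of_fwdDiff_iter (H : ∀ᶠ n in atTop, 0 < Δ_[1] ^[d] h n) :
    ∀ᶠ n in atTop, 0 < h n := by
  induction d with
  | zero => exact H
  | succ d ih =>
    simp only [Function.iterate_succ_apply'] at H
    exact ih (eventually_pos_of_fwdDiff H)

lemma le_of_fwdDiff_iter_eventuallyEq_const {a b : ℤ} (hle : h ≤ᶠ[atTop] g)
    (hh : Δ_[1] ^[d] h =ᶠ[atTop] fun _ => a) (hg : Δ_[1] ^[d] g =ᶠ[atTop] fun _ => b) :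
    a ≤ b := by
  by_contra! hab
  have diff_pos : ∀ᶠ n in atTop, 0 < Δ_[1] ^[d] (h - g) n := by
    filter_upwards [hh, hg] with n ha hb
    rw [fwdDiff_iter_sub, Pi.sub_apply, ha, hb]
    exact sub_pos.2 hab
  obtain ⟨n, hpos, hle⟩ := ((eventually_pos_of_fwdDiff_iter diff_pos).and hle).exists
  exact (sub_pos.1 hpos).not_ge hle

lemma EventuallyDegreeLT.of_le {s : ℕ} (hg : EventuallyDegreeLT g d)
    (hh : EventuallyDegreeLT h s) (h_nonneg : 0 ≤ᶠ[atTop] h) (h_le : h ≤ᶠ[atTop] g) :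
    EventuallyDegreeLT h d := by
  induction s with
  | zero => exact hh.mono d.zero_le
  | succ s ih =>
    rcases Nat.lt_or_ge s d with hsd | hsd
    · exact hh.mono hsd
    obtain ⟨c, hc⟩ := hh.exists_fwdDiff_iter_eventuallyEq_const
    have c_nonneg : 0 ≤ c := le_of_fwdDiff_iter_eventuallyEq_const h_nonneg
      (fwdDiff_iter_zero s).eventuallyEq hc
    have c_nonpos : c ≤ 0 := le_of_fwdDiff_iter_eventuallyEq_const h_le hc (hg.mono hsd)
    obtain rfl : c = 0 := le_antisymm c_nonpos c_nonneg
    exact ih hc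

end

section

/-- The sequence `n ↦ ∑ i ≤ d, (-1) ^ i * e i * binom (n + d - i) (d - i)`: a polynomial function
of degree at most `d`, in the form used to define Hilbert coefficients. -/
def binomialSum (d : ℕ) (e : Fin (d + 1) → ℤ) (n : ℕ) : ℤ :=
  ∑ i : Fin (d + 1),
    (-1) ^ (i : ℕ) * e i * (Nat.choose (n + (d - (i : ℕ))) (d - (i : ℕ)) : ℤ)

lemma binomialSum_zero (e : Fin 1 → ℤ) : binomialSum 0 e = fun _ => e 0 := by
  ext n
  simp [binomialSum]

lemma binomialSum_succ (d : ℕ) (e : Fin (d + 2) → ℤ) (n : ℕ) :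
    binomialSum (d + 1) e n = ∑ i : Fin (d + 1), (-1) ^ (i : ℕ) * e i.castSucc *
      (Nat.choose (n + (d - (i : ℕ) + 1)) (d - (i : ℕ) + 1) : ℤ) +
        (-1) ^ (d + 1) * e (Fin.last (d + 1)) := by
  rw [binomialSum, Fin.sum_univ_castSucc]
  congr 1
  · refine Finset.sum_congr rfl fun i _ => ?_
    have : d + 1 - (i : ℕ) = d - i + 1 := by omega
    simp only [Fin.val_castSucc, this]
  · simp

lemma fwdDiff_binomialSum (d : ℕ) (e : Fin (d + 2) → ℤ) :
    Δ_[1] (binomialSum (d + 1) e) = fun n => binomialSum d (e ∘ Fin.castSucc) (n + 1) := by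
  ext n
  rw [fwdDiff, binomialSum_succ, binomialSum_succ, binomialSum, add_sub_add_right_eq_sub,
    ← Finset.sum_sub_distrib]
  refine Finset.sum_congr rfl fun i _ => ?_
  rw [← add_assoc (n + 1), Nat.choose_succ_succ, add_right_comm n 1, ← add_assoc n,
    Function.comp_apply]
  push_cast
  ring

lemma fwdDiff_iter_binomialSum (d : ℕ) (e : Fin (d + 1) → ℤ) :
    Δ_[1] ^[d] (binomialSum d e) = fun _ => e 0 := by
  induction d with
  | zero => exact binomialSum_zero e
  | succ d ih =>
    ext n
    rw [Function.iterate_succ_apply, fwdDiff_binomialSum, fwdDiff_iter_comp_add, ih]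
    rfl

lemma binomialSum_snoc_add (d : ℕ) (e : Fin (d + 1) → ℤ) (c : ℤ) (n : ℕ) :
    binomialSum (d + 1) (Fin.snoc e 0) n + c =
      binomialSum (d + 1) (Fin.snoc e ((-1) ^ (d + 1) * c)) n := by
  simp only [binomialSum_succ, Fin.snoc_castSucc, Fin.snoc_last, mul_zero, add_zero, ← mul_assoc,
    ← pow_add, (Even.add_self (d + 1)).neg_one_pow, one_mul]

-- Differencing moves the argument of `binomialSum` by one, so the induction needs a free shift `s`.
lemma EventuallyDegreeLT.exists_eventuallyEq_binomialSum {h : ℕ → ℤ} {d : ℕ}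
    (hh : EventuallyDegreeLT h (d + 1)) (s : ℕ) :
    ∃ e : Fin (d + 1) → ℤ, h =ᶠ[atTop] fun n => binomialSum d e (n + s) := by
  induction d generalizing h s with
  | zero =>
    obtain ⟨c, hc⟩ := exists_eventuallyEq_const_of_fwdDiff hh
    exact ⟨fun _ => c, by simpa only [binomialSum_zero] using hc⟩
  | succ d ih =>
    obtain ⟨e, he⟩ := ih (h := Δ_[1] h) hh (s + 1)
    let b : ℕ → ℤ := fun n => binomialSum (d + 1) (Fin.snoc e 0) (n + s)
    have hb : Δ_[1] b = fun n => binomialSum d e (n + (s + 1)) := by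
      ext n
      have hsnoc : (Fin.snoc e 0 : Fin (d + 2) → ℤ) ∘ Fin.castSucc = e := by
        ext i
        simp
      rw [fwdDiff_comp_add, fwdDiff_binomialSum, hsnoc]
      rfl
    obtain ⟨c, hc⟩ : ∃ c : ℤ, h - b =ᶠ[atTop] fun _ => c := by
      refine EventuallyDegreeLT.exists_fwdDiff_iter_eventuallyEq_const (d := 0) ?_
      rw [EventuallyDegreeLT, fwdDiff_iter_sub, ← sub_self (Δ_[1] b)]
      exact EventuallyEq.sub (he.trans hb.symm.eventuallyEq) .rfl
    refine ⟨Fin.snoc e ((-1) ^ (d + 1) * c), ?_⟩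
    filter_upwards [hc] with n hn
    rw [← binomialSum_snoc_add, ← hn]
    exact (add_sub_cancel (b n) (h n)).symm

lemma exists_eventuallyEq_binomialSum_iff {h : ℕ → ℤ} {d : ℕ} {a : ℤ} :
    (∃ e : Fin (d + 1) → ℤ, h =ᶠ[atTop] binomialSum d e ∧ e 0 = a) ↔
      Δ_[1] ^[d] h =ᶠ[atTop] fun _ => a := by
  have leading : ∀ e : Fin (d + 1) → ℤ, h =ᶠ[atTop] binomialSum d e →
      Δ_[1] ^[d] h =ᶠ[atTop] fun _ => e 0 := fun e he =>
    fwdDiff_iter_binomialSum d e ▸ fwdDiff_iter_eventuallyEq he d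
  refine ⟨fun ⟨e, he, ha⟩ => ha ▸ leading e he, fun H => ?_⟩
  obtain ⟨e, he⟩ := (eventuallyDegreeLT_succ_of_fwdDiff_iter H).exists_eventuallyEq_binomialSum 0
  exact ⟨e, he, (eventuallyEq_const_iff H).1 (leading e he)⟩

end

end Sequences

section RelativeLength

variable {R : Type*} [Ring R] {M N : Type*} [AddCommGroup M] [Module R M] [AddCommGroup N]
  [Module R N]

/-- The length of the subquotient `P / (Q ⊓ P)` of `M`, the analogue for modules of the relative
index of two subgroups. -/
noncomputable def relLength (Q P : Submodule R M) : ℕ∞ :=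
  Module.length R (P ⧸ Q.submoduleOf P)

lemma relLength_self (P : Submodule R M) : relLength P P = 0 := by
  rw [relLength, Submodule.submoduleOf_self, Module.length_eq_zero_iff]
  infer_instance

lemma relLength_bot_left (P : Submodule R M) : relLength ⊥ P = Module.length R P :=
  (Submodule.quotEquivOfEqBot _ (Submodule.ker_subtype P)).length_eq

lemma relLength_top_right (Q : Submodule R M) : relLength Q ⊤ = Module.length R (M ⧸ Q) :=
  (Submodule.Quotient.equiv _ _ Submodule.topEquiv
    (Submodule.map_comap_eq_of_surjective Submodule.topEquiv.surjective Q)).length_eq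

lemma relLength_add {Q P L : Submodule R M} (hQP : Q ≤ P) (hPL : P ≤ L) :
    relLength Q P + relLength P L = relLength Q L := by
  have hcomap : (Q.submoduleOf L).comap (Submodule.inclusion hPL) = Q.submoduleOf P := rfl
  have hQP' : Q.submoduleOf L ≤ P.submoduleOf L := Submodule.comap_mono hQP
  refine (Module.length_eq_add_of_exact
    (Submodule.mapQ (Q.submoduleOf P) (Q.submoduleOf L) (Submodule.inclusion hPL) hcomap.ge)
    (Submodule.factor hQP') ?_ (Submodule.factor_surjective hQP') ?_).symm
  · rw [← LinearMap.ker_eq_bot, Submodule.ker_mapQ, hcomap, Submodule.mkQ_map_self]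
  · rw [LinearMap.exact_iff, Submodule.range_mapQ, Submodule.range_inclusion, Submodule.factor,
      Submodule.ker_mapQ, Submodule.comap_id]
    rfl

lemma relLength_le_relLength {Q Q' P' P : Submodule R M} (hQ : Q ≤ Q') (hle : Q' ≤ P')
    (hP : P' ≤ P) : relLength Q' P' ≤ relLength Q P := by
  rw [← relLength_add hQ (hle.trans hP), ← relLength_add hle hP]
  exact le_add_self.trans' le_self_add

lemma relLength_sup_map (f : M →ₗ[R] N) (Q : Submodule R N) (P : Submodule R M) :
    relLength Q (Q ⊔ P.map f) = relLength (P ⊓ Q.comap f) P := by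
  let g : P →ₗ[R] ↥(Q ⊔ P.map f) ⧸ Q.submoduleOf (Q ⊔ P.map f) :=
    (Q.submoduleOf (Q ⊔ P.map f)).mkQ ∘ₗ
      (f ∘ₗ P.subtype).codRestrict _ fun x =>
        Submodule.mem_sup_right (Submodule.mem_map_of_mem x.2)
  have hker : LinearMap.ker g = (P ⊓ Q.comap f).submoduleOf P := by
    ext x
    refine (Submodule.Quotient.mk_eq_zero (Q.submoduleOf (Q ⊔ P.map f))).trans ?_
    exact ⟨fun h => ⟨x.2, h⟩, fun h => h.2⟩
  have hsurj : Function.Surjective g := by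
    intro y
    obtain ⟨⟨y, hy⟩, rfl⟩ := Submodule.mkQ_surjective _ y
    obtain ⟨q, hq, _, ⟨p, hp, rfl⟩, rfl⟩ := Submodule.mem_sup.1 hy
    refine ⟨⟨p, hp⟩, (Submodule.Quotient.eq _).2 ?_⟩
    change f p - (q + f p) ∈ Q
    simpa using hq
  rw [relLength, relLength, ← hker]
  exact (g.quotKerEquivOfSurjective hsurj).length_eq.symm

lemma relLength_sup_of_inf_eq_bot {P W : Submodule R M} (h : P ⊓ W = ⊥) :
    relLength P (P ⊔ W) = Module.length R W := by
  have := relLength_sup_map LinearMap.id P W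
  rwa [Submodule.map_id, Submodule.comap_id, inf_comm, h, relLength_bot_left] at this

-- The Euler characteristic of the four-term exact sequence of the kernel and the cokernel of the
-- map `P / Q → P' / Q'` induced by `f`.
lemma relLength_add_relLength_ker (f : M →ₗ[R] N) {P Q : Submodule R M} {P' Q' : Submodule R N}
    (hQP : Q ≤ P) (hQP' : Q' ≤ P') (hP : P.map f ≤ P') (hQ : Q.map f ≤ Q') :
    relLength Q' P' + relLength Q (P ⊓ Q'.comap f) =
      relLength Q P + relLength (Q' ⊔ P.map f) P' := by
  rw [← relLength_add le_sup_left (sup_le hQP' hP), relLength_sup_map,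
    ← relLength_add (le_inf hQP (Submodule.map_le_iff_le_comap.1 hQ)) inf_le_left]
  abel

end RelativeLength

section HilbertSerre

variable {R : Type*} [CommRing R] {M : Type*} [AddCommGroup M] [Module R M]

/-- The graded subquotient `⨁ P n / Q n` of `M`, on which `I` acts in degree one, is Noetherian:
every graded submodule `⨁ B n / Q n` is generated by finitely many of its components. -/
structure IsNoetherianSubquotient (I : Ideal R) (P Q : ℕ → Submodule R M) : Prop where
  le : ∀ n, Q n ≤ P n
  smul_left : ∀ n, I • P n ≤ P (n + 1)
  smul_right : ∀ n, I • Q n ≤ Q (n + 1)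
  noetherian : ∀ B : ℕ → Submodule R M, (∀ n, Q n ≤ B n) → (∀ n, B n ≤ P n) →
    (∀ n, I • B n ≤ B (n + 1)) → ∀ᶠ n in atTop, B (n + 1) ≤ Q (n + 1) ⊔ I • B n

lemma span_singleton_smul_eq_map (a : R) (N : Submodule R M) :
    Ideal.span {a} • N = N.map (LinearMap.lsmul R M a) :=
  Submodule.ideal_span_singleton_smul a N

namespace IsNoetherianSubquotient

variable {I J : Ideal R} {P Q P' Q' : ℕ → Submodule R M}

lemma of_smul_le (H : IsNoetherianSubquotient (J ⊔ I) P Q)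
    (hQ : ∀ n, Q n ≤ Q' n) (hle : ∀ n, Q' n ≤ P' n) (hP : ∀ n, P' n ≤ P n)
    (hP' : ∀ n, I • P' n ≤ P' (n + 1)) (hQ' : ∀ n, I • Q' n ≤ Q' (n + 1))
    (hJ : ∀ n, J • P' n ≤ Q' (n + 1)) : IsNoetherianSubquotient I P' Q' where
  le := hle
  smul_left := hP'
  smul_right := hQ'
  noetherian B hQB hBP hB := by
    have hJB : ∀ n, J • B n ≤ Q' (n + 1) := fun n => (smul_mono_right J (hBP n)).trans (hJ n)
    have stable := H.noetherian B (fun n => (hQ n).trans (hQB n))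
      (fun n => (hBP n).trans (hP n)) fun n => by
        rw [Submodule.sup_smul]
        exact sup_le ((hJB n).trans (hQB _)) (hB n)
    filter_upwards [stable] with n hn
    rw [Submodule.sup_smul] at hn
    exact hn.trans (sup_le ((hQ _).trans le_sup_left) (sup_le_sup_right (hJB n) _))

lemma shift (H : IsNoetherianSubquotient I P Q) :
    IsNoetherianSubquotient I (fun n => P (n + 1)) (fun n => Q (n + 1)) where
  le n := H.le (n + 1)
  smul_left n := H.smul_left (n + 1)
  smul_right n := H.smul_right (n + 1)
  noetherian B hQB hBP hB := by
    let B' : ℕ → Submodule R M := fun n => Nat.casesOn n (Q 0) B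
    refine (tendsto_add_atTop_nat 1).eventually (H.noetherian B' ?_ ?_ ?_)
    · rintro (_ | n)
      exacts [le_rfl, hQB n]
    · rintro (_ | n)
      exacts [H.le 0, hBP n]
    · rintro (_ | n)
      exacts [(H.smul_right 0).trans (hQB 0), hB n]

lemma smul_left_of_le (H : IsNoetherianSubquotient J P Q) (hI : I ≤ J) (n : ℕ) :
    I • P n ≤ P (n + 1) :=
  (Submodule.smul_mono_left hI).trans (H.smul_left n)

lemma smul_right_of_le (H : IsNoetherianSubquotient J P Q) (hI : I ≤ J) (n : ℕ) :
    I • Q n ≤ Q (n + 1) :=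
  (Submodule.smul_mono_left hI).trans (H.smul_right n)

variable {a : R}

lemma map_left_le (H : IsNoetherianSubquotient (Ideal.span {a} ⊔ I) P Q) (n : ℕ) :
    (P n).map (LinearMap.lsmul R M a) ≤ P (n + 1) :=
  span_singleton_smul_eq_map a (P n) ▸ H.smul_left_of_le le_sup_left n

lemma map_right_le (H : IsNoetherianSubquotient (Ideal.span {a} ⊔ I) P Q) (n : ℕ) :
    (Q n).map (LinearMap.lsmul R M a) ≤ Q (n + 1) :=
  span_singleton_smul_eq_map a (Q n) ▸ H.smul_right_of_le le_sup_left n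

lemma ker (H : IsNoetherianSubquotient (Ideal.span {a} ⊔ I) P Q) :
    IsNoetherianSubquotient I
      (fun n => P n ⊓ (Q (n + 1)).comap (LinearMap.lsmul R M a)) Q := by
  refine H.of_smul_le (fun _ => le_rfl)
    (fun n => le_inf (H.le n) (Submodule.map_le_iff_le_comap.1 (H.map_right_le n)))
    (fun _ => inf_le_left) (fun n => le_inf ?_ ?_) (H.smul_right_of_le le_sup_right) fun n => ?_
  · exact (smul_mono_right I inf_le_left).trans (H.smul_left_of_le le_sup_right n)
  · rw [← Submodule.map_le_iff_le_comap, Submodule.map_smul'']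
    exact (smul_mono_right I (Submodule.map_le_iff_le_comap.2 inf_le_right)).trans
      (H.smul_right_of_le le_sup_right (n + 1))
  · rw [span_singleton_smul_eq_map]
    exact Submodule.map_le_iff_le_comap.2 inf_le_right

lemma coker (H : IsNoetherianSubquotient (Ideal.span {a} ⊔ I) P Q) :
    IsNoetherianSubquotient I (fun n => P (n + 1))
      (fun n => Q (n + 1) ⊔ (P n).map (LinearMap.lsmul R M a)) := by
  refine H.shift.of_smul_le (fun _ => le_sup_left)
    (fun n => sup_le (H.le (n + 1)) (H.map_left_le n)) (fun _ => le_rfl)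
    (fun n => H.smul_left_of_le le_sup_right (n + 1)) (fun n => ?_) fun n => ?_
  · rw [Submodule.smul_sup, ← Submodule.map_smul'']
    exact sup_le_sup (H.smul_right_of_le le_sup_right (n + 1))
      (Submodule.map_mono (H.smul_left_of_le le_sup_right n))
  · rw [span_singleton_smul_eq_map]
    exact le_sup_right

lemma eventually_relLength_eq_zero (H : IsNoetherianSubquotient (⊥ : Ideal R) P Q) :
    ∀ᶠ n in atTop, relLength (Q n) (P n) = 0 := by
  refine eventually_atTop.2 ?_
  obtain ⟨k, hk⟩ := eventually_atTop.1 (H.noetherian P H.le (fun _ => le_rfl) H.smul_left)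
  refine ⟨k + 1, fun n hn => ?_⟩
  obtain ⟨m, rfl⟩ := Nat.exists_eq_add_of_le' hn
  have hle := hk (m + k) (Nat.le_add_left k m)
  rw [Submodule.bot_smul, sup_bot_eq] at hle
  rw [← add_assoc, (H.le _).antisymm hle, relLength_self]

lemma fwdDiff_relLength (H : IsNoetherianSubquotient (Ideal.span {a} ⊔ I) P Q)
    (hfin : ∀ n, relLength (Q n) (P n) ≠ ⊤) :
    Δ_[1] (fun n => ((relLength (Q n) (P n)).toNat : ℤ)) =
      (fun n => ((relLength (Q (n + 1) ⊔ (P n).map (LinearMap.lsmul R M a))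
        (P (n + 1))).toNat : ℤ)) -
      fun n => ((relLength (Q n)
        (P n ⊓ (Q (n + 1)).comap (LinearMap.lsmul R M a))).toNat : ℤ) := by
  ext n
  have euler := congr_arg ENat.toNat (relLength_add_relLength_ker (LinearMap.lsmul R M a)
    (H.le n) (H.le (n + 1)) (H.map_left_le n) (H.map_right_le n))
  have hker : relLength (Q n) (P n ⊓ (Q (n + 1)).comap (LinearMap.lsmul R M a)) ≠ ⊤ :=
    ne_top_of_le_ne_top (hfin n) (relLength_le_relLength le_rfl (H.ker.le n) inf_le_left)
  have hcoker : relLength (Q (n + 1) ⊔ (P n).map (LinearMap.lsmul R M a)) (P (n + 1)) ≠ ⊤ :=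
    ne_top_of_le_ne_top (hfin (n + 1)) (relLength_le_relLength le_sup_left (H.coker.le n) le_rfl)
  rw [ENat.toNat_add (hfin _) hker, ENat.toNat_add (hfin _) hcoker] at euler
  simp only [fwdDiff, Pi.sub_apply]
  omega

theorem eventuallyDegreeLT_relLength (s : Finset R) {P Q : ℕ → Submodule R M}
    (H : IsNoetherianSubquotient (Ideal.span (s : Set R)) P Q)
    (hfin : ∀ n, relLength (Q n) (P n) ≠ ⊤) :
    EventuallyDegreeLT (fun n => ((relLength (Q n) (P n)).toNat : ℤ)) s.card := by
  classical
  induction s using Finset.induction_on generalizing P Q with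
  | empty =>
    rw [Finset.coe_empty, Ideal.span_empty] at H
    filter_upwards [H.eventually_relLength_eq_zero] with n hn
    simp [hn]
  | insert a s ha ih =>
    rw [Finset.coe_insert, Ideal.span_insert] at H
    rw [Finset.card_insert_of_notMem ha, EventuallyDegreeLT, Function.iterate_succ_apply,
      H.fwdDiff_relLength hfin]
    refine EventuallyDegreeLT.sub (ih H.coker fun n => ?_) (ih H.ker fun n => ?_)
    · exact ne_top_of_le_ne_top (hfin (n + 1))
        (relLength_le_relLength le_sup_left (H.coker.le n) le_rfl)
    · exact ne_top_of_le_ne_top (hfin n)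
        (relLength_le_relLength le_rfl (H.ker.le n) inf_le_left)

end IsNoetherianSubquotient

end HilbertSerre

section AdicFiltration

variable {R : Type*} [CommRing R] {M : Type*} [AddCommGroup M] [Module R M] {I J : Ideal R}

lemma smul_pow_smul_top (I : Ideal R) (n : ℕ) :
    I • I ^ n • (⊤ : Submodule R M) = I ^ (n + 1) • ⊤ := by
  rw [pow_succ', mul_smul]

lemma pow_smul_top_antitone (I : Ideal R) :
    Antitone fun n => I ^ n • (⊤ : Submodule R M) := fun _ _ h =>
  Submodule.smul_mono_left (Ideal.pow_le_pow_right h)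

lemma pow_mul_smul_top_le {k : ℕ} (h : J ^ k • (⊤ : Submodule R M) ≤ I • ⊤) (n : ℕ) :
    J ^ (k * n) • (⊤ : Submodule R M) ≤ I ^ n • ⊤ := by
  induction n with
  | zero => simp
  | succ n ih =>
    calc J ^ (k * (n + 1)) • (⊤ : Submodule R M)
        = J ^ (k * n) • J ^ k • ⊤ := by rw [Nat.mul_succ, pow_add, mul_smul]
      _ ≤ J ^ (k * n) • I • ⊤ := smul_mono_right _ h
      _ = I • J ^ (k * n) • ⊤ := by rw [← mul_smul, mul_comm, mul_smul]
      _ ≤ I • I ^ n • ⊤ := smul_mono_right _ ih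
      _ = I ^ (n + 1) • ⊤ := smul_pow_smul_top I n

variable (M I) in
/-- The Hilbert–Samuel function `n ↦ ℓ(M / I ^ n M)` of `M` with respect to `I`, with junk value
`0` where the length is infinite. The Hilbert polynomial interpolates `ℓ(M / I ^ (n + 1) M)`, that
is, `fun n => adicColength M I (n + 1)`. -/
noncomputable def adicColength (n : ℕ) : ℤ :=
  (Module.length R (M ⧸ (I ^ n • (⊤ : Submodule R M)))).toNat

lemma adicColength_le_adicColength (hJI : J ≤ I) {n : ℕ}
    (hfin : Module.length R (M ⧸ (J ^ n • (⊤ : Submodule R M))) ≠ ⊤) :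
    adicColength M I n ≤ adicColength M J n := by
  have hle : J ^ n • (⊤ : Submodule R M) ≤ I ^ n • ⊤ :=
    Submodule.smul_mono_left (Ideal.pow_right_mono hJI n)
  exact Int.ofNat_le.2 (ENat.toNat_le_toNat
    (Module.length_le_of_surjective _ (Submodule.factor_surjective hle)) hfin)

lemma length_quotient_pow_succ_smul_top (I : Ideal R) (n : ℕ) :
    Module.length R (M ⧸ (I ^ (n + 1) • (⊤ : Submodule R M))) =
      relLength (I ^ (n + 1) • (⊤ : Submodule R M)) (I ^ n • ⊤) +
        Module.length R (M ⧸ (I ^ n • (⊤ : Submodule R M))) := by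
  rw [← relLength_top_right, ← relLength_top_right,
    relLength_add (pow_smul_top_antitone I n.le_succ) le_top]

lemma relLength_pow_succ_ne_top
    (hfin : ∀ n, Module.length R (M ⧸ (I ^ n • (⊤ : Submodule R M))) ≠ ⊤) (n : ℕ) :
    relLength (I ^ (n + 1) • (⊤ : Submodule R M)) (I ^ n • ⊤) ≠ ⊤ :=
  ne_top_of_le_ne_top (hfin (n + 1))
    ((length_quotient_pow_succ_smul_top (M := M) I n).ge.trans' le_self_add)

lemma fwdDiff_adicColength
    (hfin : ∀ n, Module.length R (M ⧸ (I ^ n • (⊤ : Submodule R M))) ≠ ⊤) :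
    Δ_[1] (adicColength M I) = fun n =>
      ((relLength (I ^ (n + 1) • (⊤ : Submodule R M)) (I ^ n • ⊤)).toNat : ℤ) := by
  ext n
  rw [fwdDiff, adicColength, adicColength, length_quotient_pow_succ_smul_top,
    ENat.toNat_add (relLength_pow_succ_ne_top hfin n) (hfin n), Nat.cast_add, add_sub_cancel_right]

lemma length_ne_top_of_le_annihilator [I.IsMaximal] [Module.Finite R M]
    (h : I ≤ Module.annihilator R M) : Module.length R M ≠ ⊤ := by
  have htors : Module.IsTorsionBySet R M I := fun x r => Module.mem_annihilator.1 (h r.2) x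
  let : Module (R ⧸ I) M := htors.module
  have : IsScalarTower R (R ⧸ I) M := htors.isScalarTower
  let : Field (R ⧸ I) := Ideal.Quotient.field I
  have : Module.Finite (R ⧸ I) M := Module.Finite.of_restrictScalars_finite R _ _
  rw [Module.length_eq_of_surjective (R := R ⧸ I) Ideal.Quotient.mk_surjective]
  exact Module.length_ne_top

lemma relLength_smul_ne_top [I.IsMaximal] (P : Submodule R M) [Module.Finite R P] :
    relLength (I • P) P ≠ ⊤ := by
  refine length_ne_top_of_le_annihilator (I := I) fun r hr => Module.mem_annihilator.2 fun x => ?_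
  obtain ⟨x, rfl⟩ := Submodule.mkQ_surjective _ x
  exact (Submodule.Quotient.mk_eq_zero _).2 (Submodule.smul_mem_smul hr x.2)

lemma length_quotient_pow_smul_top_ne_top [I.IsMaximal] [IsNoetherian R M] (n : ℕ) :
    Module.length R (M ⧸ (I ^ n • (⊤ : Submodule R M))) ≠ ⊤ := by
  induction n with
  | zero =>
    rw [← relLength_top_right, pow_zero, one_smul, relLength_self]
    exact ENat.zero_ne_top
  | succ n ih =>
    rw [length_quotient_pow_succ_smul_top, ← smul_pow_smul_top]
    exact WithTop.add_ne_top.2 ⟨relLength_smul_ne_top _, ih⟩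

variable [IsNoetherianRing R] [Module.Finite R M]

lemma isNoetherianSubquotient_pow_smul_top (I : Ideal R) :
    IsNoetherianSubquotient I (fun n => I ^ n • (⊤ : Submodule R M))
      (fun n => I ^ (n + 1) • (⊤ : Submodule R M)) where
  le n := pow_smul_top_antitone I n.le_succ
  smul_left n := (smul_pow_smul_top I n).le
  smul_right n := (smul_pow_smul_top I (n + 1)).le
  noetherian B hQB hBP hB := by
    let F : I.Filtration M := ⟨B, fun i => (hBP (i + 1)).trans (hQB i), hB⟩
    obtain ⟨k, hk⟩ := (Ideal.stableFiltration_stable I (⊤ : Submodule R M)).of_le (F' := F) hBP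
    filter_upwards [eventually_ge_atTop k] with n hn
    exact (hk n hn).ge.trans le_sup_right

lemma eventuallyDegreeLT_adicColength_span (s : Finset R)
    (hfin : ∀ n,
      Module.length R (M ⧸ (Ideal.span (s : Set R) ^ n • (⊤ : Submodule R M))) ≠ ⊤) :
    EventuallyDegreeLT (adicColength M (Ideal.span (s : Set R))) (s.card + 1) := by
  rw [EventuallyDegreeLT, Function.iterate_succ_apply, fwdDiff_adicColength hfin]
  exact (isNoetherianSubquotient_pow_smul_top _).eventuallyDegreeLT_relLength s
    (relLength_pow_succ_ne_top hfin)

end AdicFiltration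

section Parameters

open IsLocalRing

lemma exists_finset_card_le_map_span_eq {R A : Type*} [CommRing R] [CommRing A] {f : R →+* A}
    (hf : Function.Surjective f) (s : Finset A) :
    ∃ s' : Finset R, s'.card ≤ s.card ∧
      (Ideal.span (s' : Set R)).map f = Ideal.span (s : Set A) := by
  classical
  refine ⟨s.image (Function.surjInv hf), Finset.card_image_le, ?_⟩
  rw [Ideal.map_span, Finset.coe_image, ← Set.image_comp, Function.comp_surjInv hf, Set.image_id]

lemma exists_finset_card_eq_ringKrullDim (A : Type*) [CommRing A] [IsLocalRing A]
    [IsNoetherianRing A] :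
    ∃ s : Finset A, (s.card : WithBot ℕ∞) = ringKrullDim A ∧
      Ideal.span (s : Set A) ≤ maximalIdeal A ∧
      ∃ k, maximalIdeal A ^ k ≤ Ideal.span (s : Set A) := by
  obtain ⟨s, hmin, hcard⟩ := (maximalIdeal A).exists_finset_card_eq_height_of_isNoetherianRing
  have hrad : (Ideal.span (s : Set A)).radical = maximalIdeal A := by
    rw [Ideal.radical_eq_sInf]
    refine le_antisymm (sInf_le ⟨hmin.1.2, hmin.1.1⟩) (le_sInf ?_)
    rintro p ⟨hp, hprime⟩
    exact hmin.2 ⟨hprime, hp⟩ (le_maximalIdeal hprime.ne_top)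
  refine ⟨s, ?_, hmin.1.2, ?_⟩
  · rw [← maximalIdeal_height_eq_ringKrullDim, ← hcard]
    rfl
  · obtain ⟨k, hk⟩ := (Ideal.span (s : Set A)).exists_radical_pow_le_of_fg
      (IsNoetherian.noetherian _)
    exact ⟨k, hrad ▸ hk⟩

variable {R : Type*} [CommRing R] [IsLocalRing R] [IsNoetherianRing R]
  {M : Type*} [AddCommGroup M] [Module R M] [Module.Finite R M] {t : ℕ}

lemma exists_finset_card_le_supportDim (hdim : Module.supportDim R M = t) :
    ∃ s : Finset R, s.card ≤ t ∧ Ideal.span (s : Set R) ≤ maximalIdeal R ∧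
      ∃ k, maximalIdeal R ^ k • (⊤ : Submodule R M) ≤ Ideal.span (s : Set R) • ⊤ := by
  have : Nontrivial M := by
    rw [← Module.supportDim_ne_bot_iff_nontrivial R, hdim]
    exact WithBot.coe_ne_bot
  let f := Ideal.Quotient.mk (Module.annihilator R M)
  have hf : Function.Surjective f := Ideal.Quotient.mk_surjective
  have : Nontrivial (R ⧸ Module.annihilator R M) :=
    Ideal.Quotient.nontrivial_iff.2 (mt Module.annihilator_eq_top_iff.1 (not_subsingleton M))
  have : IsLocalRing (R ⧸ Module.annihilator R M) := IsLocalRing.of_surjective' f hf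
  obtain ⟨s', hcard', hle', k, hk'⟩ :=
    exists_finset_card_eq_ringKrullDim (R ⧸ Module.annihilator R M)
  obtain ⟨s, hcard, hmap⟩ := exists_finset_card_le_map_span_eq hf s'
  rw [← Module.supportDim_eq_ringKrullDim_quotient_annihilator, hdim] at hcard'
  refine ⟨s, hcard.trans (by exact_mod_cast hcard'.le), ?_, k, ?_⟩
  · rw [← hmap, Ideal.map_le_iff_le_comap] at hle'
    exact hle'.trans (le_maximalIdeal (Ideal.comap_ne_top f Ideal.IsPrime.ne_top'))
  · rw [← hmap, ← map_maximalIdeal_of_surjective f hf, ← Ideal.map_pow, Ideal.map_le_iff_le_comap,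
      Ideal.comap_map_of_surjective' f hf, Ideal.mk_ker] at hk'
    refine (Submodule.smul_mono_left hk').trans ?_
    rw [Submodule.sup_smul, ← Submodule.annihilator_top, Submodule.annihilator_smul, sup_bot_eq]

theorem eventuallyDegreeLT_adicColength_maximalIdeal (hdim : Module.supportDim R M = t) :
    EventuallyDegreeLT (adicColength M (maximalIdeal R)) (t + 1) := by
  obtain ⟨s, hcard, hs, k, hk⟩ := exists_finset_card_le_supportDim hdim
  obtain ⟨r, hr⟩ := IsNoetherian.noetherian (maximalIdeal R)
  have hfin : ∀ n, Module.length R (M ⧸ (Ideal.span (s : Set R) ^ n • (⊤ : Submodule R M))) ≠ ⊤ :=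
    fun n => ne_top_of_le_ne_top (length_quotient_pow_smul_top_ne_top (I := maximalIdeal R) (k * n))
      (Module.length_le_of_surjective _ (Submodule.factor_surjective (pow_mul_smul_top_le hk n)))
  have polynomial := eventuallyDegreeLT_adicColength_span (M := M) r
  rw [Ideal.span, hr] at polynomial
  exact ((eventuallyDegreeLT_adicColength_span s hfin).mono (Nat.succ_le_succ hcard)).of_le
    (polynomial length_quotient_pow_smul_top_ne_top)
    (Eventually.of_forall fun _ => Int.natCast_nonneg _)
    (Eventually.of_forall fun n => adicColength_le_adicColength hs (hfin n))

end Parameters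

section Colon

variable {R : Type*} [CommRing R] {M N : Type*} [AddCommGroup M] [Module R M] [AddCommGroup N]
  [Module R N]

lemma moduleColon_mono {P Q : Submodule R M} (h : P ≤ Q) (J : Ideal R) :
    moduleColon P J ≤ moduleColon Q J := fun _ hx r hr => h (hx r hr)

lemma le_moduleColon_iff {P Q : Submodule R M} {J : Ideal R} :
    P ≤ moduleColon Q J ↔ J • P ≤ Q := by
  rw [Submodule.smul_le]
  exact ⟨fun h r hr x hx => h hx r hr, fun h x hx r hr => h r hr x hx⟩

lemma pow_smul_top_le_moduleColon (I : Ideal R) (n : ℕ) :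
    I ^ n • ⊤ ≤ moduleColon (I ^ (n + 1) • (⊤ : Submodule R M)) I :=
  le_moduleColon_iff.2 (smul_pow_smul_top I n).le

lemma moduleColon_span (Q : Submodule R M) (s : Set R) :
    moduleColon Q (Ideal.span s) = (Submodule.pi Set.univ fun _ : s => Q).comap
      (LinearMap.pi fun a : s => LinearMap.lsmul R M (a : R)) := by
  ext x
  have hspan : x ∈ moduleColon Q (Ideal.span s) ↔
      Ideal.span s ≤ Q.comap (LinearMap.toSpanSingleton R M x) := Iff.rfl
  rw [hspan, Ideal.span, Submodule.span_le]
  exact ⟨fun h a _ => h a.2, fun h a ha => h ⟨a, ha⟩ trivial⟩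

lemma pi_smul_top_le {ι : Type*} [Finite ι] (I : Ideal R) :
    Submodule.pi Set.univ (fun _ : ι => I • (⊤ : Submodule R M)) ≤ I • ⊤ := by
  classical
  cases nonempty_fintype ι
  intro x hx
  rw [← Finset.univ_sum_single x]
  refine Submodule.sum_mem _ fun i _ => ?_
  have hmem := Submodule.mem_map_of_mem (f := LinearMap.single R (fun _ : ι => M) i)
    (hx i trivial)
  rw [Submodule.map_smul''] at hmem
  exact Submodule.smul_mono le_rfl le_top hmem

variable [IsNoetherianRing R]

lemma exists_comap_pow_smul_top_le [Module.Finite R N] (I : Ideal R) (f : M →ₗ[R] N) :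
    ∃ c, ∀ n, (I ^ (n + c) • (⊤ : Submodule R N)).comap f ≤
      I ^ n • (⊤ : Submodule R M) ⊔ LinearMap.ker f := by
  obtain ⟨c, hc⟩ := I.exists_pow_inf_eq_pow_smul (LinearMap.range f)
  refine ⟨c, fun n => ?_⟩
  rw [← Submodule.comap_map_eq, Submodule.map_smul'', Submodule.map_top]
  intro x hx
  have hfx : f x ∈ I ^ (n + c) • (⊤ : Submodule R N) ⊓ LinearMap.range f := ⟨hx, x, rfl⟩
  rw [hc (n + c) (Nat.le_add_left c n), Nat.add_sub_cancel] at hfx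
  exact Submodule.smul_mono le_rfl inf_le_right hfx

variable [Module.Finite R M]

lemma exists_moduleColon_pow_le_sup (I J : Ideal R) :
    ∃ c, ∀ n, moduleColon (I ^ (n + c) • (⊤ : Submodule R M)) J ≤
      I ^ n • ⊤ ⊔ moduleColon ⊥ J := by
  obtain ⟨s, rfl⟩ : ∃ s : Finset R, Ideal.span (s : Set R) = J := IsNoetherian.noetherian J
  obtain ⟨c, hc⟩ := exists_comap_pow_smul_top_le I
    (LinearMap.pi fun a : (s : Set R) => LinearMap.lsmul R M (a : R))
  refine ⟨c, fun n => ?_⟩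
  rw [moduleColon_span, moduleColon_span, Submodule.pi_univ_bot, Submodule.comap_bot]
  exact (Submodule.comap_mono (pi_smul_top_le _)).trans (hc n)

-- The submodules on the left form a filtration contained in the `I`-adic one, hence are eventually
-- obtained from one another by multiplication with `I`, which raises the degree by two.
lemma eventually_moduleColon_pow_inf_le (I : Ideal R) :
    ∀ᶠ j in atTop, moduleColon (I ^ (j + 2) • (⊤ : Submodule R M)) I ⊓ I ^ j • ⊤ ≤
      I ^ (j + 1) • ⊤ := by
  have pow_le (j : ℕ) : I ^ (j + 1) • (⊤ : Submodule R M) ≤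
      moduleColon (I ^ (j + 2) • (⊤ : Submodule R M)) I ⊓ I ^ j • ⊤ :=
    le_inf (pow_smul_top_le_moduleColon I (j + 1)) (pow_smul_top_antitone I j.le_succ)
  have smul_le (j : ℕ) : I • (moduleColon (I ^ (j + 2) • (⊤ : Submodule R M)) I ⊓ I ^ j • ⊤) ≤
      I ^ (j + 2) • ⊤ := le_moduleColon_iff.1 inf_le_left
  let F : I.Filtration M :=
    ⟨fun j => moduleColon (I ^ (j + 2) • (⊤ : Submodule R M)) I ⊓ I ^ j • ⊤,
      fun j => inf_le_right.trans (pow_le j), fun j => (smul_le j).trans (pow_le (j + 1))⟩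
  obtain ⟨k, hk⟩ := (Ideal.stableFiltration_stable I (⊤ : Submodule R M)).of_le (F' := F)
    fun j => inf_le_right
  refine eventually_atTop.2 ⟨k + 1, fun j hj => ?_⟩
  obtain ⟨j, rfl⟩ := Nat.exists_eq_add_of_le' (k.succ_pos.trans_le hj)
  exact (hk j (Nat.le_of_succ_le_succ hj)).ge.trans (smul_le j)

lemma exists_forall_moduleColon_pow_inf_le (I : Ideal R) :
    ∃ m, ∀ n ≥ m, moduleColon (I ^ (n + 1) • (⊤ : Submodule R M)) I ⊓ I ^ m • ⊤ ≤
      I ^ n • ⊤ := by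
  obtain ⟨m, hm⟩ := eventually_atTop.1 (eventually_moduleColon_pow_inf_le (M := M) I)
  refine ⟨m, fun n hn => ?_⟩
  suffices ∀ j ≥ m, j ≤ n → moduleColon (I ^ (n + 1) • (⊤ : Submodule R M)) I ⊓ I ^ m • ⊤ ≤
      I ^ j • ⊤ from this n hn le_rfl
  intro j hj
  induction j, hj using Nat.le_induction with
  | base => exact fun _ => inf_le_right
  | succ j hj ih =>
    intro hjn
    have hcolon : moduleColon (I ^ (n + 1) • (⊤ : Submodule R M)) I ≤
        moduleColon (I ^ (j + 2) • ⊤) I :=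
      moduleColon_mono (pow_smul_top_antitone I (Nat.succ_le_succ hjn)) I
    exact (le_inf (inf_le_left.trans hcolon) (ih (Nat.le_of_succ_le hjn))).trans (hm j hj)

lemma eventually_moduleColon_pow_eq (I : Ideal R) :
    ∀ᶠ n in atTop, moduleColon (I ^ (n + 1) • (⊤ : Submodule R M)) I =
      I ^ n • ⊤ ⊔ moduleColon ⊥ I := by
  obtain ⟨c, hc⟩ := exists_moduleColon_pow_le_sup (M := M) I I
  obtain ⟨m, hm⟩ := exists_forall_moduleColon_pow_inf_le (M := M) I
  filter_upwards [eventually_ge_atTop (m + c)] with n hn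
  have socle_le : moduleColon ⊥ I ≤ moduleColon (I ^ (n + 1) • (⊤ : Submodule R M)) I :=
    moduleColon_mono bot_le I
  refine le_antisymm ?_ (sup_le (pow_smul_top_le_moduleColon I n) socle_le)
  have hle : moduleColon (I ^ (n + 1) • (⊤ : Submodule R M)) I ≤
      moduleColon ⊥ I ⊔ I ^ m • ⊤ := by
    rw [sup_comm]
    exact (moduleColon_mono (pow_smul_top_antitone I (hn.trans n.le_succ)) I).trans (hc m)
  calc moduleColon (I ^ (n + 1) • (⊤ : Submodule R M)) I
      = (moduleColon ⊥ I ⊔ I ^ m • ⊤) ⊓ moduleColon (I ^ (n + 1) • ⊤) I :=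
        (inf_eq_right.2 hle).symm
    _ = moduleColon ⊥ I ⊔ I ^ m • ⊤ ⊓ moduleColon (I ^ (n + 1) • ⊤) I :=
        sup_inf_assoc_of_le _ socle_le
    _ ≤ moduleColon ⊥ I ⊔ I ^ n • ⊤ := by
        rw [inf_comm]
        exact sup_le_sup_left (hm n (Nat.le_of_add_right_le hn)) _
    _ = I ^ n • ⊤ ⊔ moduleColon ⊥ I := sup_comm _ _

lemma eventually_pow_inf_moduleColon_bot_eq_bot (I : Ideal R) :
    ∀ᶠ n in atTop, I ^ n • ⊤ ⊓ moduleColon (⊥ : Submodule R M) I = ⊥ := by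
  obtain ⟨c, hc⟩ := I.exists_pow_inf_eq_pow_smul (moduleColon (⊥ : Submodule R M) I)
  filter_upwards [eventually_gt_atTop c] with n hn
  rw [hc n hn.le, eq_bot_iff]
  calc I ^ (n - c) • (I ^ c • ⊤ ⊓ moduleColon (⊥ : Submodule R M) I)
      ≤ I • moduleColon (⊥ : Submodule R M) I :=
        Submodule.smul_mono (Ideal.pow_le_self (Nat.sub_ne_zero_of_lt hn)) inf_le_right
    _ ≤ ⊥ := le_moduleColon_iff.1 le_rfl

theorem eventually_relLength_moduleColon_pow (I : Ideal R) :
    ∀ᶠ n in atTop, relLength (I ^ (n + 1) • (⊤ : Submodule R M))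
        (moduleColon (I ^ (n + 1) • ⊤) I) =
      relLength (I ^ (n + 1) • (⊤ : Submodule R M)) (I ^ n • ⊤) +
        Module.length R (moduleColon (⊥ : Submodule R M) I) := by
  filter_upwards [eventually_moduleColon_pow_eq (M := M) I,
    eventually_pow_inf_moduleColon_bot_eq_bot (M := M) I] with n hcolon hinf
  rw [← relLength_add (pow_smul_top_antitone I n.le_succ) (pow_smul_top_le_moduleColon I n),
    hcolon, relLength_sup_of_inf_eq_bot hinf]

end Colon

section Multiplicities

open IsLocalRing

lemma exists_eq_natCast_and_eq_iff {x : ℕ∞} (hx : x ≠ ⊤) {b : ℤ} :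
    (∃ k : ℕ, x = k ∧ (k : ℤ) = b) ↔ (x.toNat : ℤ) = b := by
  lift x to ℕ using hx
  simp

variable {R : Type*} [CommRing R] {M : Type*} [AddCommGroup M] [Module R M] {t d : ℕ} {a : ℤ}

lemma hasHilbertCoeffs_iff {I : Ideal R}
    (hfin : ∀ n, Module.length R (M ⧸ (I ^ n • (⊤ : Submodule R M))) ≠ ⊤)
    {e : Fin (t + 1) → ℤ} :
    HasHilbertCoeffs M I t e ↔ (fun n => adicColength M I (n + 1)) =ᶠ[atTop] binomialSum t e :=
  eventually_congr (Eventually.of_forall fun n => exists_eq_natCast_and_eq_iff (hfin (n + 1)))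

theorem isHilbertMultiplicity_iff {I : Ideal R}
    (hfin : ∀ n, Module.length R (M ⧸ (I ^ n • (⊤ : Submodule R M))) ≠ ⊤)
    (hdim : Module.supportDim R M = t) :
    IsHilbertMultiplicity M I a ↔ Δ_[1] ^[t] (adicColength M I) =ᶠ[atTop] fun _ => a := by
  have hshift : (Δ_[1] ^[t] fun n => adicColength M I (n + 1)) =
      fun n => Δ_[1] ^[t] (adicColength M I) (n + 1) :=
    funext fun n => fwdDiff_iter_comp_add 1 _ 1 t n
  calc IsHilbertMultiplicity M I a
      ↔ ∃ e : Fin (t + 1) → ℤ, HasHilbertCoeffs M I t e ∧ e 0 = a := by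
        simp only [IsHilbertMultiplicity, hdim, Nat.cast_inj, exists_eq_left']
    _ ↔ (Δ_[1] ^[t] fun n => adicColength M I (n + 1)) =ᶠ[atTop] fun _ => a := by
        simp only [hasHilbertCoeffs_iff hfin, exists_eventuallyEq_binomialSum_iff]
    _ ↔ Δ_[1] ^[t] (adicColength M I) =ᶠ[atTop] fun _ => a := by
        rw [hshift]
        exact Filter.ext_iff.1 (map_add_atTop_eq_nat 1) {n | Δ_[1] ^[t] (adicColength M I) n = a}

lemma length_moduleColon_bot_ne_top (I : Ideal R) [I.IsMaximal] [IsNoetherian R M] :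
    Module.length R (moduleColon (⊥ : Submodule R M) I) ≠ ⊤ :=
  length_ne_top_of_le_annihilator (I := I) fun r hr =>
    Module.mem_annihilator.2 fun x => Subtype.ext (x.2 r hr)

variable [IsLocalRing R] [IsNoetherianRing R] [Module.Finite R M] {w : ℕ}

lemma hasIrreducibilityCoeffs_iff
    (hw : Module.length R (moduleColon (⊥ : Submodule R M) (maximalIdeal R)) = w)
    {f : Fin (d + 1) → ℤ} :
    HasIrreducibilityCoeffs M (maximalIdeal R) (d + 1) f ↔
      (Δ_[1] (adicColength M (maximalIdeal R)) + fun _ => (w : ℤ)) =ᶠ[atTop] binomialSum d f := by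
  have hfin := length_quotient_pow_smul_top_ne_top (M := M) (I := maximalIdeal R)
  refine eventually_congr ?_
  filter_upwards [eventually_relLength_moduleColon_pow (M := M) (maximalIdeal R)] with n hn
  have hn_fin := relLength_pow_succ_ne_top hfin n
  have hsum : relLength (maximalIdeal R ^ (n + 1) • (⊤ : Submodule R M))
      (maximalIdeal R ^ n • ⊤) + w ≠ ⊤ := WithTop.add_ne_top.2 ⟨hn_fin, ENat.natCast_ne_top w⟩
  rw [hw] at hn
  refine (exists_eq_natCast_and_eq_iff (hn.trans_ne hsum)).trans ?_
  rw [hn, ENat.toNat_add hn_fin (ENat.natCast_ne_top w), ENat.toNat_natCast,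
    fwdDiff_adicColength hfin, Pi.add_apply, Nat.cast_add]
  rfl

theorem isIrreducibleMultiplicity_iff
    (hw : Module.length R (moduleColon (⊥ : Submodule R M) (maximalIdeal R)) = w)
    (hdim : Module.supportDim R M = (d + 1 : ℕ)) :
    IsIrreducibleMultiplicity M (maximalIdeal R) a ↔
      Δ_[1] ^[d] (Δ_[1] (adicColength M (maximalIdeal R)) + fun _ => (w : ℤ)) =ᶠ[atTop]
        fun _ => a := by
  rw [← exists_eventuallyEq_binomialSum_iff]
  simp only [← hasIrreducibilityCoeffs_iff hw]
  constructor
  · rintro ⟨t, _, ht, hf⟩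
    obtain rfl : t = d + 1 := by exact_mod_cast ht.symm.trans hdim
    exact hf
  · exact fun hf => ⟨d + 1, d.succ_pos, hdim, hf⟩

end Multiplicities

end IrrMult

open IrrMult

theorem mainTheorem2 {R : Type*} [CommRing R] [IsLocalRing R] [IsNoetherianRing R]
    (M : Type*) [AddCommGroup M] [Module R M] [Module.Finite R M]
    (t : ℕ) (ht : 1 ≤ t) (hdim : Module.supportDim R M = (t : WithBot ℕ∞)) :
    (∃! e : ℤ, IrrMult.IsHilbertMultiplicity M (IsLocalRing.maximalIdeal R) e) ∧
    (∃! f : ℤ, IrrMult.IsIrreducibleMultiplicity M (IsLocalRing.maximalIdeal R) f) ∧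
    ∀ e f : ℤ, IrrMult.IsHilbertMultiplicity M (IsLocalRing.maximalIdeal R) e →
      IrrMult.IsIrreducibleMultiplicity M (IsLocalRing.maximalIdeal R) f →
      (t ≠ 1 → f = e) ∧
      (t = 1 → ∃ s : ℕ,
        Module.length R (IrrMult.moduleColon (⊥ : Submodule R M) (IsLocalRing.maximalIdeal R))
          = (s : ℕ∞) ∧ f = e + (s : ℤ)) := by
  obtain ⟨d, rfl⟩ := Nat.exists_eq_add_of_le' ht
  obtain ⟨c, hc⟩ :=
    (eventuallyDegreeLT_adicColength_maximalIdeal hdim).exists_fwdDiff_iter_eventuallyEq_const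
  obtain ⟨w, hw⟩ := ENat.ne_top_iff_exists.1
    (length_moduleColon_bot_ne_top (M := M) (IsLocalRing.maximalIdeal R))
  have hilbert_iff (a : ℤ) : IsHilbertMultiplicity M (IsLocalRing.maximalIdeal R) a ↔ a = c :=
    (isHilbertMultiplicity_iff length_quotient_pow_smul_top_ne_top hdim).trans
      (eventuallyEq_const_iff hc)
  have irreducible_iff (a : ℤ) : IsIrreducibleMultiplicity M (IsLocalRing.maximalIdeal R) a ↔
      a = c + if d = 0 then (w : ℤ) else 0 :=
    (isIrreducibleMultiplicity_iff hw.symm hdim).trans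
      (eventuallyEq_const_iff (fwdDiff_iter_fwdDiff_add_const hc w))
  simp only [hilbert_iff, irreducible_iff, existsUnique_eq, true_and]
  rintro _ _ rfl rfl
  refine ⟨fun hd => ?_, fun hd => ⟨w, hw.symm, ?_⟩⟩
  · rw [if_neg (by omega), add_zero]
  · rw [if_pos (by omega)]
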